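/- Let $m,p$ be integers with $m$ even and $0<m\le p$. Equip $SO(p)$ with the bi-invariant Riemannian metric given at the identity by $g(A_1,A_2)=-\tfrac12\operatorname{tr}(A_1A_2)$ for antisymmetric matrices $A_1,A_2$, and let $d_{SO}$ be its geodesic distance (the infimum of the lengths of curves joining two points). Let $\mathrm{Gr}_m(\mathbf R^p)$ be the set of $m$-dimensional linear subspaces of $\mathbf R^p$, and for $W,V\in \mathrm{Gr}_m(\mathbf R^p)$ put $$d_{Gr}(W,V)=\Big(\sum_{i=1}^m\phi_i(W,V)^2\Big)^{1/2},$$ where $\phi_1(W,V),\dots,\phi_m(W,V)\in[0,\pi/2]$ are the principal angles between $W$ and $V$, defined recursively by $\cos\phi_k=\max\langle x,y\rangle=\langle u_k,v_k\rangle$, the maximum being over unit vectors $x\in W$, $y\in V$ with $x\perp u_i$ and $y\perp v_i$ for all $i<k$, and $(u_k,v_k)$ being a maximizing pair. Let $\mathrm{Inv}_m(p)$ be the set of $R\in SO(p)$ with $R^2=I\ne R$ whose $(-1)$-eigenspace has dimension $m$. For a subspace $W$, let $P_W$ denote the matrix, in the standard basis, of the orthogonal projection of $\mathbf R^p$ onto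 $W$. Then the map $\Phi:(\mathrm{Gr}_m(\mathbf R^p),d_{Gr})\to(\mathrm{Inv}_m(p),d_{SO})$, $\Phi(W)=I-2P_W$, is an isometry up to a constant factor of 2: it is a bijection, and $$d_{SO}(\Phi(W),\Phi(V))=2\,d_{Gr}(W,V)\qquad\text{for all } W,V\in \mathrm{Gr}_m(\mathbf R^p).$$ -/

import Mathlib

open Module Set

namespace GrassmannInvolution

noncomputable section

/-- Real `p × p` matrices. -/
abbrev Mat (p : ℕ) : Type := Matrix (Fin p) (Fin p) ℝ

/-- The Euclidean space `ℝ^p`. -/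
abbrev E (p : ℕ) : Type := EuclideanSpace ℝ (Fin p)

/-- The special orthogonal group `SO(p)`. -/
abbrev SO (p : ℕ) : Type := Matrix.specialOrthogonalGroup (Fin p) ℝ

/-! ### The bi-invariant Riemannian metric on `SO(p)` and its geodesic distance -/

/-- The inner product `-(1/2) tr(A B)` on the Lie algebra of antisymmetric matrices. -/
def soInner {p : ℕ} (A B : Mat p) : ℝ := -(1 / 2) * (A * B).trace

/-- The bi-invariant Riemannian metric on `SO(p)`: tangent vectors `X`, `Y` at `U` (matrices with
`X U⁻¹`, `Y U⁻¹` antisymmetric) are carried to the identity by right translation. -/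
def soMetric {p : ℕ} (U : SO p) (X Y : Mat p) : ℝ :=
  soInner (X * ((U⁻¹ : SO p) : Mat p)) (Y * ((U⁻¹ : SO p) : Mat p))

/-- `γ`, restricted to `[0,1]`, is a `C¹` curve in `SO(p)`. -/
def IsC1Curve {p : ℕ} (γ : ℝ → SO p) : Prop :=
  ∀ i j, ContDiffOn ℝ 1 (fun t => (γ t : Mat p) i j) (Icc 0 1)

/-- The velocity at time `t` of a curve `[0,1] → SO(p)` (one-sided at the endpoints). -/
def velocity {p : ℕ} (γ : ℝ → SO p) (t : ℝ) : Mat p :=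
  Matrix.of fun i j => derivWithin (fun s => (γ s : Mat p) i j) (Icc 0 1) t

/-- The Riemannian length of a curve `[0,1] → SO(p)`. -/
def curveLength {p : ℕ} (γ : ℝ → SO p) : ℝ :=
  ∫ t in (0 : ℝ)..1, Real.sqrt (soMetric (γ t) (velocity γ t) (velocity γ t))

/-- The geodesic distance on `SO(p)`: the infimum of the lengths of the `C¹` curves joining two
points. -/
def dSO {p : ℕ} (U V : SO p) : ℝ :=
  sInf {L : ℝ | ∃ γ : ℝ → SO p, IsC1Curve γ ∧ γ 0 = U ∧ γ 1 = V ∧ L = curveLength γ}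

/-! ### The Grassmannian and principal angles -/

/-- The Grassmannian of `m`-planes in `ℝ^p`. -/
def Gr (m p : ℕ) : Type := {W : Submodule ℝ (E p) // finrank ℝ W = m}

/-- The first `m` pairs of principal vectors of the subspaces `W` and `Z`: recursively, `(u k, v k)`
maximizes `⟪x, y⟫` over the unit vectors `x ∈ W`, `y ∈ Z` that are orthogonal to the earlier `u i`,
respectively to the earlier `v i`. -/
structure IsPrincipalVectors {p m : ℕ} (W Z : Submodule ℝ (E p)) (u v : Fin m → E p) : Prop where
  mem_left : ∀ k, u k ∈ W
  mem_right : ∀ k, v k ∈ Z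
  norm_left : ∀ k, ‖u k‖ = 1
  norm_right : ∀ k, ‖v k‖ = 1
  orth_left : ∀ k, ∀ i < k, inner ℝ (u i) (u k) = 0
  orth_right : ∀ k, ∀ i < k, inner ℝ (v i) (v k) = 0
  maximal : ∀ k, ∀ x ∈ W, ∀ y ∈ Z, ‖x‖ = 1 → ‖y‖ = 1 →
    (∀ i < k, inner ℝ (u i) x = 0) → (∀ i < k, inner ℝ (v i) y = 0) →
    inner ℝ x y ≤ inner ℝ (u k) (v k)

/-- `φ` lists the first `m` principal angles between `W` and `Z`: `φ k ∈ [0, π/2]` and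
`cos (φ k) = ⟪u k, v k⟫` for principal vectors `u`, `v`. -/
def IsPrincipalAngles {p m : ℕ} (W Z : Submodule ℝ (E p)) (φ : Fin m → ℝ) : Prop :=
  ∃ u v : Fin m → E p, IsPrincipalVectors W Z u v ∧
    ∀ k, φ k ∈ Icc 0 (Real.pi / 2) ∧ Real.cos (φ k) = inner ℝ (u k) (v k)

lemma exists_unit_orth {p : ℕ} (W : Submodule ℝ (E p)) {n : ℕ} (hn : n < finrank ℝ W)
    (u : Fin n → E p) : ∃ x ∈ W, ‖x‖ = 1 ∧ ∀ i, inner ℝ (u i) x = 0 := by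
  let f : W →ₗ[ℝ] (Fin n → ℝ) :=
    LinearMap.pi fun i => (innerSL ℝ (u i)).toLinearMap ∘ₗ W.subtype
  have hk : f.ker ≠ ⊥ := by
    apply LinearMap.ker_ne_bot_of_finrank_lt
    simpa using hn
  obtain ⟨x, hx, hx0⟩ := (Submodule.ne_bot_iff _).1 hk
  have hx0' : (x : E p) ≠ 0 := by simpa using hx0
  refine ⟨(‖(x : E p)‖⁻¹ : ℝ) • (x : E p), W.smul_mem _ x.2, ?_, fun i => ?_⟩
  · rw [norm_smul, norm_inv, norm_norm, inv_mul_cancel₀ (norm_ne_zero_iff.2 hx0')]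
  · have h1 : f x i = 0 := by rw [LinearMap.mem_ker.1 hx]; rfl
    have h2 : inner ℝ (u i) (x : E p) = 0 := h1
    rw [inner_smul_right, h2, mul_zero]

lemma exists_isPrincipalVectors {p : ℕ} (W Z : Submodule ℝ (E p)) (n : ℕ)
    (hW : n ≤ finrank ℝ W) (hZ : n ≤ finrank ℝ Z) :
    ∃ u v : Fin n → E p, IsPrincipalVectors W Z u v := by
  induction n with
  | zero =>
    exact ⟨Fin.elim0, Fin.elim0, ⟨fun k => k.elim0, fun k => k.elim0, fun k => k.elim0,
      fun k => k.elim0, fun k => k.elim0, fun k => k.elim0, fun k => k.elim0⟩⟩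
  | succ n ih =>
    obtain ⟨u, v, h⟩ := ih (by omega) (by omega)
    let A : Set (E p) := {x | x ∈ W ∧ ‖x‖ = 1 ∧ ∀ i, inner ℝ (u i) x = 0}
    let B : Set (E p) := {y | y ∈ Z ∧ ‖y‖ = 1 ∧ ∀ i, inner ℝ (v i) y = 0}
    have key : ∀ (Y : Submodule ℝ (E p)) (w : Fin n → E p),
        IsCompact {x : E p | x ∈ Y ∧ ‖x‖ = 1 ∧ ∀ i, inner ℝ (w i) x = 0} := by
      intro Y w
      refine (isCompact_sphere (0 : E p) 1).of_isClosed_subset ?_ ?_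
      · refine (Y.closed_of_finiteDimensional).inter ((isClosed_eq continuous_norm
          continuous_const).inter ?_)
        have : {x : E p | ∀ i, inner ℝ (w i) x = 0} = ⋂ i, {x : E p | inner ℝ (w i) x = 0} := by
          ext; simp
        change IsClosed {x : E p | ∀ i, inner ℝ (w i) x = 0}
        rw [this]
        exact isClosed_iInter fun i => isClosed_eq (by fun_prop) continuous_const
      · rintro x ⟨-, hx, -⟩
        simpa using hx
    have hAB : IsCompact (A ×ˢ B) := (key W u).prod (key Z v)
    have hne : (A ×ˢ B).Nonempty := by
      obtain ⟨x, hx1, hx2, hx3⟩ := exists_unit_orth W (Nat.lt_of_succ_le hW) u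
      obtain ⟨y, hy1, hy2, hy3⟩ := exists_unit_orth Z (Nat.lt_of_succ_le hZ) v
      exact ⟨(x, y), ⟨hx1, hx2, hx3⟩, ⟨hy1, hy2, hy3⟩⟩
    obtain ⟨⟨a, b⟩, ⟨⟨ha1, ha2, ha3⟩, ⟨hb1, hb2, hb3⟩⟩, hmax⟩ :=
      hAB.exists_isMaxOn hne (f := fun q : E p × E p => inner ℝ q.1 q.2)
        (by fun_prop)
    refine ⟨Fin.snoc u a, Fin.snoc v b, ?_, ?_, ?_, ?_, ?_, ?_, ?_⟩
    · intro k; cases k using Fin.lastCases <;> simp [ha1, h.mem_left]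
    · intro k; cases k using Fin.lastCases <;> simp [hb1, h.mem_right]
    · intro k; cases k using Fin.lastCases <;> simp [ha2, h.norm_left]
    · intro k; cases k using Fin.lastCases <;> simp [hb2, h.norm_right]
    · intro k i hi
      cases k using Fin.lastCases with
      | last =>
        cases i using Fin.lastCases with
        | last => exact absurd hi (lt_irrefl _)
        | cast i => simp [ha3]
      | cast k =>
        cases i using Fin.lastCases with
        | last => exact absurd hi (not_lt.2 (Fin.le_last _))
        | cast i => simpa using h.orth_left k i (by simpa using hi)
    · intro k i hi
      cases k using Fin.lastCases with
      | last =>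
        cases i using Fin.lastCases with
        | last => exact absurd hi (lt_irrefl _)
        | cast i => simp [hb3]
      | cast k =>
        cases i using Fin.lastCases with
        | last => exact absurd hi (not_lt.2 (Fin.le_last _))
        | cast i => simpa using h.orth_right k i (by simpa using hi)
    · intro k x hx y hy hx1 hy1 hxo hyo
      cases k using Fin.lastCases with
      | last =>
        have hxA : x ∈ A := ⟨hx, hx1, fun i => by
          simpa using hxo (Fin.castSucc i) (Fin.castSucc_lt_last i)⟩
        have hyB : y ∈ B := ⟨hy, hy1, fun i => by
          simpa using hyo (Fin.castSucc i) (Fin.castSucc_lt_last i)⟩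
        have := hmax (show (x, y) ∈ A ×ˢ B from ⟨hxA, hyB⟩)
        simpa using this
      | cast k =>
        have := h.maximal k x hx y hy hx1 hy1
          (fun i hi => by simpa using hxo (Fin.castSucc i) (by simpa using hi))
          (fun i hi => by simpa using hyo (Fin.castSucc i) (by simpa using hi))
        simpa using this

/-- Principal angles exist. -/
theorem exists_isPrincipalAngles {p : ℕ} (W Z : Submodule ℝ (E p)) (m : ℕ)
    (hW : m ≤ finrank ℝ W) (hZ : m ≤ finrank ℝ Z) :
    ∃ φ : Fin m → ℝ, IsPrincipalAngles W Z φ := by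
  obtain ⟨u, v, h⟩ := exists_isPrincipalVectors W Z m hW hZ
  refine ⟨fun k => Real.arccos (inner ℝ (u k) (v k)), u, v, h, fun k => ?_⟩
  have hle : inner ℝ (u k) (v k) ≤ 1 := by
    have := real_inner_le_norm (u k) (v k)
    rwa [h.norm_left, h.norm_right, one_mul] at this
  have hge : 0 ≤ inner ℝ (u k) (v k) := by
    have := h.maximal k (u k) (h.mem_left k) (-(v k)) (Z.neg_mem (h.mem_right k))
      (h.norm_left k) (by rw [norm_neg, h.norm_right]) (h.orth_left k)
      (fun i hi => by rw [inner_neg_right, h.orth_right k i hi, neg_zero])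
    rw [inner_neg_right] at this
    linarith
  exact ⟨⟨Real.arccos_nonneg _, Real.arccos_le_pi_div_two.2 hge⟩,
    Real.cos_arccos (by linarith) hle⟩

/-- Interchanging the two subspaces. -/
lemma IsPrincipalVectors.symm {p m : ℕ} {W Z : Submodule ℝ (E p)} {u v : Fin m → E p}
    (h : IsPrincipalVectors W Z u v) : IsPrincipalVectors Z W v u where
  mem_left := h.mem_right
  mem_right := h.mem_left
  norm_left := h.norm_right
  norm_right := h.norm_left
  orth_left := h.orth_right
  orth_right := h.orth_left
  maximal k x hx y hy hx1 hy1 hxo hyo := by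
    rw [real_inner_comm, real_inner_comm (u k)]
    exact h.maximal k y hy x hx hy1 hx1 hyo hxo

lemma IsPrincipalVectors.inner_nonneg {p m : ℕ} {W Z : Submodule ℝ (E p)} {u v : Fin m → E p}
    (h : IsPrincipalVectors W Z u v) (k : Fin m) : 0 ≤ inner ℝ (u k) (v k) := by
  have := h.maximal k (u k) (h.mem_left k) (-(v k)) (Z.neg_mem (h.mem_right k))
    (h.norm_left k) (by rw [norm_neg, h.norm_right]) (h.orth_left k)
    (fun i hi => by rw [inner_neg_right, h.orth_right k i hi, neg_zero])
  rw [inner_neg_right] at this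
  linarith

lemma IsPrincipalVectors.inner_le {p m : ℕ} {W Z : Submodule ℝ (E p)} {u v : Fin m → E p}
    (h : IsPrincipalVectors W Z u v) (k : Fin m) {x y : E p} (hx : x ∈ W) (hy : y ∈ Z)
    (hxo : ∀ i < k, inner ℝ (u i) x = 0) (hyo : ∀ i < k, inner ℝ (v i) y = 0) :
    inner ℝ x y ≤ inner ℝ (u k) (v k) * (‖x‖ * ‖y‖) := by
  rcases eq_or_ne x 0 with rfl | hx0
  · simp
  rcases eq_or_ne y 0 with rfl | hy0
  · simp
  have hx1 : 0 < ‖x‖ := norm_pos_iff.2 hx0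
  have hy1 : 0 < ‖y‖ := norm_pos_iff.2 hy0
  have := h.maximal k ((‖x‖⁻¹ : ℝ) • x) (W.smul_mem _ hx) ((‖y‖⁻¹ : ℝ) • y) (Z.smul_mem _ hy)
    (by rw [norm_smul, norm_inv, norm_norm, inv_mul_cancel₀ hx1.ne'])
    (by rw [norm_smul, norm_inv, norm_norm, inv_mul_cancel₀ hy1.ne'])
    (fun i hi => by rw [inner_smul_right, hxo i hi, mul_zero])
    (fun i hi => by rw [inner_smul_right, hyo i hi, mul_zero])
  rw [inner_smul_left, inner_smul_right, ← mul_assoc] at this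
  simp only [conj_trivial] at this
  rw [← mul_inv, inv_mul_le_iff₀ (by positivity)] at this
  linarith

lemma IsPrincipalVectors.inner_right_eq_zero {p m : ℕ} {W Z : Submodule ℝ (E p)}
    {u v : Fin m → E p} (h : IsPrincipalVectors W Z u v) (k : Fin m) {x : E p} (hx : x ∈ W)
    (hxo : ∀ i ≤ k, inner ℝ (u i) x = 0) : inner ℝ x (v k) = 0 := by
  have hs := h.inner_nonneg k
  have key : ∀ t : ℝ, 2 * (t * inner ℝ x (v k)) ≤ inner ℝ (u k) (v k) * (t ^ 2 * ‖x‖ ^ 2) := by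
    intro t
    have h1 := h.inner_le k (x := u k + t • x) (W.add_mem (h.mem_left k) (W.smul_mem t hx))
      (h.mem_right k) (fun i hi => by
        rw [inner_add_right, inner_smul_right, h.orth_left k i hi, hxo i hi.le]; simp)
      (h.orth_right k)
    have h2 : ‖u k + t • x‖ ^ 2 = 1 + t ^ 2 * ‖x‖ ^ 2 := by
      rw [norm_add_sq_real, h.norm_left, inner_smul_right, hxo k le_rfl, norm_smul, mul_pow,
        Real.norm_eq_abs, sq_abs]
      ring
    have h3 : 2 * ‖u k + t • x‖ ≤ 2 + t ^ 2 * ‖x‖ ^ 2 := by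
      nlinarith [sq_nonneg (‖u k + t • x‖ - 1)]
    rw [inner_add_left, inner_smul_left, h.norm_right, mul_one] at h1
    simp only [conj_trivial] at h1
    nlinarith [mul_le_mul_of_nonneg_left h3 hs]
  by_contra hc
  set c := inner ℝ x (v k) with hcd
  set N := inner ℝ (u k) (v k) * ‖x‖ ^ 2 with hN
  have hN0 : 0 ≤ N := by positivity
  clear_value N
  have h4 := key (c / (N + 1))
  have h5 : 0 < c ^ 2 := by positivity
  have h6 : 2 * (c / (N + 1) * c) = 2 * c ^ 2 / (N + 1) := by ring
  have h7 : inner ℝ (u k) (v k) * ((c / (N + 1)) ^ 2 * ‖x‖ ^ 2) = c ^ 2 * N / (N + 1) ^ 2 := by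
    calc _ = c ^ 2 * (inner ℝ (u k) (v k) * ‖x‖ ^ 2) / (N + 1) ^ 2 := by rw [div_pow]; ring
      _ = _ := by rw [← hN]
  rw [h6, h7, div_le_div_iff₀ (by positivity) (by positivity)] at h4
  nlinarith [mul_pos h5 (show 0 < N + 1 by linarith),
    mul_nonneg (mul_pos h5 (show 0 < N + 1 by linarith)).le hN0]

lemma IsPrincipalVectors.inner_cross {p m : ℕ} {W Z : Submodule ℝ (E p)} {u v : Fin m → E p}
    (h : IsPrincipalVectors W Z u v) {i j : Fin m} (hij : i ≠ j) : inner ℝ (u i) (v j) = 0 := by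
  rcases lt_or_gt_of_ne hij with hlt | hgt
  · rw [real_inner_comm]
    exact h.symm.inner_right_eq_zero i (h.mem_right j) fun l hl =>
      h.orth_right j l (hl.trans_lt hlt)
  · exact h.inner_right_eq_zero j (h.mem_left i) fun l hl => h.orth_left i l (hl.trans_lt hgt)

lemma IsPrincipalVectors.cos_le {p m : ℕ} {W Z : Submodule ℝ (E p)} {u v u' v' : Fin m → E p}
    (h : IsPrincipalVectors W Z u v) (h' : IsPrincipalVectors W Z u' v') (k : Fin m) :
    inner ℝ (u' k) (v' k) ≤ inner ℝ (u k) (v k) := by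
  have hanti : ∀ i ≤ k, inner ℝ (u' k) (v' k) ≤ inner ℝ (u' i) (v' i) := fun i hi =>
    h'.maximal i _ (h'.mem_left k) _ (h'.mem_right k) (h'.norm_left k) (h'.norm_right k)
      (fun l hl => h'.orth_left k l (hl.trans_le hi))
      (fun l hl => h'.orth_right k l (hl.trans_le hi))
  let f : (Fin (k + 1) → ℝ) →ₗ[ℝ] (Fin k → ℝ) :=
    LinearMap.pi fun j => ∑ i : Fin (k + 1),
      (inner ℝ (u (Fin.castLE k.2.le j)) (u' (Fin.castLE k.2 i))) • LinearMap.proj i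
  have hk : f.ker ≠ ⊥ := LinearMap.ker_ne_bot_of_finrank_lt (by simp)
  obtain ⟨c, hc, hc0⟩ := (Submodule.ne_bot_iff _).1 hk
  have hc1 : ∀ j, f c j = 0 := fun j => by rw [LinearMap.mem_ker.1 hc]; rfl
  let a : Fin (k + 1) → E p := fun i => u' (Fin.castLE k.2 i)
  let b : Fin (k + 1) → E p := fun i => v' (Fin.castLE k.2 i)
  let x : E p := ∑ i, c i • a i
  let y : E p := ∑ i, c i • b i
  let S : ℝ := ∑ i, c i ^ 2
  have hS : 0 < S := by
    obtain ⟨i, hi⟩ := Function.ne_iff.1 hc0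
    exact Finset.sum_pos' (fun i _ => sq_nonneg _) ⟨i, Finset.mem_univ _, by
      have : c i ≠ 0 := hi
      positivity⟩
  have hinj : ∀ {i j : Fin (k + 1)}, i ≠ j →
      (Fin.castLE k.2 i : Fin m) ≠ Fin.castLE k.2 j := fun hij e =>
    hij (Fin.castLE_injective _ e)
  have bil : ∀ (g g' : Fin (k + 1) → E p), (∀ i j, i ≠ j → inner ℝ (g i) (g' j) = 0) →
      inner ℝ (∑ i, c i • g i) (∑ i, c i • g' i) = ∑ i, c i ^ 2 * inner ℝ (g i) (g' i) := by
    intro g g' hg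
    rw [sum_inner]
    refine Finset.sum_congr rfl fun i _ => ?_
    rw [inner_sum, Finset.sum_eq_single i]
    · rw [inner_smul_left, inner_smul_right]; simp only [conj_trivial]; ring
    · intro j _ hj
      rw [inner_smul_left, inner_smul_right, hg i j hj.symm]; simp
    · simp
  have horth : ∀ {w : Fin m → E p}, (∀ k, ∀ i < k, inner ℝ (w i) (w k) = 0) →
      ∀ i j, i ≠ j → inner ℝ (w i) (w j) = 0 := by
    intro w hw i j hij
    rcases lt_or_gt_of_ne hij with hlt | hgt
    · exact hw j i hlt
    · rw [real_inner_comm]; exact hw i j hgt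
  have hxx : ‖x‖ ^ 2 = S := by
    rw [← real_inner_self_eq_norm_sq]
    refine (bil a a fun i j hij => horth h'.orth_left _ _ (hinj hij)).trans ?_
    simp [S, a, h'.norm_left]
  have hyy : ‖y‖ ^ 2 = S := by
    rw [← real_inner_self_eq_norm_sq]
    refine (bil b b fun i j hij => horth h'.orth_right _ _ (hinj hij)).trans ?_
    simp [S, b, h'.norm_right]
  have hxy : inner ℝ (u' k) (v' k) * S ≤ inner ℝ x y := by
    have : inner ℝ x y = ∑ i, c i ^ 2 * inner ℝ (a i) (b i) :=
      bil a b fun i j hij => h'.inner_cross (hinj hij)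
    rw [this, Finset.mul_sum]
    refine Finset.sum_le_sum fun i _ => ?_
    rw [mul_comm]
    exact mul_le_mul_of_nonneg_left (hanti _ (Fin.le_def.2 (Nat.lt_succ_iff.1 i.2)))
      (sq_nonneg _)
  have hxW : x ∈ W := W.sum_mem fun i _ => W.smul_mem _ (h'.mem_left _)
  have hyZ : y ∈ Z := Z.sum_mem fun i _ => Z.smul_mem _ (h'.mem_right _)
  have hxo : ∀ j < k, inner ℝ (u j) x = 0 := by
    intro j hj
    have h1 := hc1 ⟨j, hj⟩
    simp only [f, LinearMap.pi_apply, LinearMap.sum_apply, LinearMap.smul_apply,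
      LinearMap.proj_apply, smul_eq_mul] at h1
    rw [inner_sum, ← h1]
    refine Finset.sum_congr rfl fun i _ => ?_
    rw [inner_smul_right, mul_comm]
    rfl
  have hxv : ∀ j < k, inner ℝ x (v j) = 0 := fun j hj =>
    h.inner_right_eq_zero j hxW fun i hi => hxo i (hi.trans_lt hj)
  let K : Submodule ℝ (E p) := Submodule.span ℝ (v '' Iio k)
  have hKZ : K ≤ Z := Submodule.span_le.2 (by rintro _ ⟨j, -, rfl⟩; exact h.mem_right j)
  have hKx : ∀ z ∈ K, inner ℝ x z = 0 := by
    intro z hz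
    have : K ≤ (ℝ ∙ x)ᗮ := Submodule.span_le.2 (by
      rintro _ ⟨j, hj, rfl⟩
      exact Submodule.mem_orthogonal_singleton_iff_inner_right.2 (hxv j hj))
    exact Submodule.mem_orthogonal_singleton_iff_inner_right.1 (this hz)
  have hy2 : Kᗮ.starProjection y = y - K.starProjection y := by
    rw [eq_sub_iff_add_eq, add_comm]
    exact K.starProjection_add_starProjection_orthogonal y
  have hPK : K.starProjection y ∈ K := K.starProjection_apply_mem y
  have h1 := h.inner_le k hxW (y := Kᗮ.starProjection y)
    (by rw [hy2]; exact Z.sub_mem hyZ (hKZ hPK)) hxo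
    (fun i hi => (Submodule.mem_orthogonal K _).1 (Kᗮ.starProjection_apply_mem y) (v i)
      (Submodule.subset_span ⟨i, hi, rfl⟩))
  have h2 : inner ℝ x (Kᗮ.starProjection y) = inner ℝ x y := by
    rw [hy2, inner_sub_right, hKx _ hPK, sub_zero]
  have h3 : ‖Kᗮ.starProjection y‖ ≤ ‖y‖ := Kᗮ.norm_starProjection_apply_le y
  have h4 : ‖x‖ * ‖y‖ = S := by
    have : ‖y‖ = ‖x‖ := by
      rw [← abs_norm y, ← abs_norm x]; exact sq_eq_sq_iff_abs_eq_abs _ _ |>.1 (hyy.trans hxx.symm)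
    rw [this, ← sq, hxx]
  have h5 : inner ℝ (u k) (v k) * (‖x‖ * ‖Kᗮ.starProjection y‖) ≤ inner ℝ (u k) (v k) * S := by
    rw [← h4]
    exact mul_le_mul_of_nonneg_left (mul_le_mul_of_nonneg_left h3 (norm_nonneg x))
      (h.inner_nonneg k)
  exact le_of_mul_le_mul_right (by linarith) hS

/-- The principal angles are determined by the two subspaces. -/
theorem IsPrincipalAngles.unique {p m : ℕ} {W Z : Submodule ℝ (E p)} {φ φ' : Fin m → ℝ}
    (h : IsPrincipalAngles W Z φ) (h' : IsPrincipalAngles W Z φ') : φ = φ' := by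
  obtain ⟨u, v, h1, h2⟩ := h
  obtain ⟨u', v', h1', h2'⟩ := h'
  funext k
  have hpi := Real.pi_pos
  refine Real.injOn_cos ⟨(h2 k).1.1, (h2 k).1.2.trans (by linarith)⟩
    ⟨(h2' k).1.1, (h2' k).1.2.trans (by linarith)⟩ ?_
  rw [(h2 k).2, (h2' k).2]
  exact le_antisymm (h1'.cos_le h1 k) (h1.cos_le h1' k)

/-- The principal angles `φ_1(W,Z), …, φ_m(W,Z)` of two `m`-planes. -/
def principalAngle {m p : ℕ} (W Z : Gr m p) : Fin m → ℝ :=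
  (exists_isPrincipalAngles W.1 Z.1 m W.2.ge Z.2.ge).choose

theorem principalAngle_spec {m p : ℕ} (W Z : Gr m p) :
    IsPrincipalAngles W.1 Z.1 (principalAngle W Z) :=
  (exists_isPrincipalAngles W.1 Z.1 m W.2.ge Z.2.ge).choose_spec

/-- The distance on the Grassmannian: the root of the sum of the squared principal angles. -/
def dGr {m p : ℕ} (W Z : Gr m p) : ℝ := Real.sqrt (∑ i, principalAngle W Z i ^ 2)

/-! ### Involutions and the map `W ↦ I - 2 P_W` -/

/-- The `(-1)`-eigenspace of a matrix. -/
def negEigenspace {p : ℕ} (R : Mat p) : Submodule ℝ (E p) :=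
  Module.End.eigenspace (Matrix.toEuclideanLin R) (-1)

/-- `Inv_m(p)`: the involutions in `SO(p)` of level `m`, that is, whose `(-1)`-eigenspace has
dimension `m`. -/
def Inv (m p : ℕ) : Type :=
  {R : SO p // R * R = 1 ∧ R ≠ 1 ∧ finrank ℝ (negEigenspace (R : Mat p)) = m}

/-- The matrix, in the standard basis, of the orthogonal projection of `ℝ^p` onto `W`. -/
def projMatrix {p : ℕ} (W : Submodule ℝ (E p)) : Mat p :=
  LinearMap.toMatrix (EuclideanSpace.basisFun (Fin p) ℝ).toBasis
    (EuclideanSpace.basisFun (Fin p) ℝ).toBasis (W.starProjection : E p →ₗ[ℝ] E p)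

lemma toEuclideanLin_projMatrix {p : ℕ} (W : Submodule ℝ (E p)) :
    Matrix.toEuclideanLin (projMatrix W) = (W.starProjection : E p →ₗ[ℝ] E p) := by
  rw [projMatrix, Matrix.toEuclideanLin_eq_toLin_orthonormal, Matrix.toLin_toMatrix]

lemma toEuclideanLin_one_sub {p : ℕ} (W : Submodule ℝ (E p)) (x : E p) :
    Matrix.toEuclideanLin (1 - 2 • projMatrix W) x = x - (2 : ℝ) • W.starProjection x := by
  rw [map_sub, map_nsmul, toEuclideanLin_projMatrix, Matrix.toEuclideanLin_eq_toLin_orthonormal,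
    Matrix.toLin_one]
  simp [two_smul]

lemma negEigenspace_one_sub {p : ℕ} (W : Submodule ℝ (E p)) :
    negEigenspace (1 - 2 • projMatrix W) = W := by
  ext x
  rw [negEigenspace, Module.End.mem_eigenspace_iff, toEuclideanLin_one_sub, neg_one_smul]
  rw [← Submodule.starProjection_eq_self_iff]
  constructor
  · intro h
    have : (2 : ℝ) • W.starProjection x = (2 : ℝ) • x := by
      rw [two_smul ℝ x]
      rw [sub_eq_iff_eq_add] at h
      have h2 := congrArg (x + ·) h
      simpa using h2.symm
    exact smul_right_injective _ (two_ne_zero) this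
  · intro h
    rw [h, two_smul]; abel

lemma projMatrix_mul_self {p : ℕ} (W : Submodule ℝ (E p)) :
    projMatrix W * projMatrix W = projMatrix W := by
  apply (Matrix.toEuclideanLin (𝕜 := ℝ) (m := Fin p) (n := Fin p)).injective
  rw [Matrix.toEuclideanLin_eq_toLin_orthonormal,
    Matrix.toLin_mul _ (EuclideanSpace.basisFun (Fin p) ℝ).toBasis,
    ← Matrix.toEuclideanLin_eq_toLin_orthonormal, toEuclideanLin_projMatrix]
  ext1 x
  simp [Submodule.starProjection_eq_self_iff]

lemma projMatrix_transpose {p : ℕ} (W : Submodule ℝ (E p)) :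
    (projMatrix W).transpose = projMatrix W := by
  ext i j
  simp only [Matrix.transpose_apply, projMatrix, LinearMap.toMatrix_apply,
    OrthonormalBasis.coe_toBasis, OrthonormalBasis.coe_toBasis_repr_apply,
    OrthonormalBasis.repr_apply_apply, ContinuousLinearMap.coe_coe]
  rw [real_inner_comm]
  exact W.inner_starProjection_left_eq_right _ _

lemma one_sub_mul_self {p : ℕ} (W : Submodule ℝ (E p)) :
    (1 - 2 • projMatrix W) * (1 - 2 • projMatrix W) = 1 := by
  have h := projMatrix_mul_self W
  rw [sub_mul, mul_sub, mul_sub, smul_mul_smul_comm, h]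
  simp only [mul_one, one_mul]
  module

lemma det_one_sub {p : ℕ} (W : Submodule ℝ (E p)) :
    (1 - 2 • projMatrix W).det = (-1) ^ finrank ℝ W := by
  have h1 : Matrix.toEuclideanLin (1 - 2 • projMatrix W) = Wᗮ.reflection.toLinearMap := by
    ext1 x
    rw [toEuclideanLin_one_sub]
    change _ = Wᗮ.reflection x
    rw [Submodule.reflection_orthogonal_apply, Submodule.reflection_apply, neg_sub, two_smul,
      two_smul]
  have h2 := Wᗮ.det_reflection
  rw [← h1, Matrix.toEuclideanLin_eq_toLin_orthonormal, LinearMap.det_toLin,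
    Submodule.orthogonal_orthogonal] at h2
  exact h2

/-- The matrix `I - 2 P_W` lies in `SO(p)` when `W` has even dimension. -/
theorem one_sub_mem_SO {m p : ℕ} (hm : Even m) (W : Gr m p) :
    1 - 2 • projMatrix W.1 ∈ Matrix.specialOrthogonalGroup (Fin p) ℝ := by
  rw [Matrix.mem_specialOrthogonalGroup_iff, Matrix.mem_orthogonalGroup_iff]
  refine ⟨?_, ?_⟩
  · rw [Matrix.transpose_sub, Matrix.transpose_one, Matrix.transpose_smul, projMatrix_transpose,
      one_sub_mul_self]
  · rw [det_one_sub, W.2, hm.neg_one_pow]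

/-- The map `Φ : Gr_m(ℝ^p) → Inv_m(p)`, `W ↦ I - 2 P_W`, for even `m > 0`. -/
def Phi {m p : ℕ} (hm : Even m) (hm0 : 0 < m) (W : Gr m p) : Inv m p :=
  ⟨⟨1 - 2 • projMatrix W.1, one_sub_mem_SO hm W⟩, Subtype.ext (one_sub_mul_self W.1), by
    intro h
    have h1 : (1 - 2 • projMatrix W.1 : Mat p) = 1 := congrArg Subtype.val h
    have h2 : projMatrix W.1 = 0 := by
      rw [sub_eq_self] at h1
      ext i j
      have h2 : (2 • projMatrix W.1) i j = 0 := by rw [h1]; rfl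
      rw [Matrix.smul_apply, nsmul_eq_mul] at h2
      simpa using h2
    have h3 : (W.1.starProjection : E p →ₗ[ℝ] E p) = 0 := by
      rw [← toEuclideanLin_projMatrix, h2, map_zero]
    have h4 : W.1 = ⊥ := by
      rw [eq_bot_iff]
      intro x hx
      have h5 : W.1.starProjection x = 0 := LinearMap.congr_fun h3 x
      rwa [Submodule.starProjection_eq_self_iff.2 hx] at h5
    have h6 := W.2
    rw [h4, finrank_bot] at h6
    omega, by
    change finrank ℝ (negEigenspace (1 - 2 • projMatrix W.1)) = m
    rw [negEigenspace_one_sub, W.2]⟩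

end

end GrassmannInvolution

open GrassmannInvolution

/-!
Principal vectors `u k ∈ W`, `v k ∈ V` span mutually orthogonal planes, and `v k` arises from `u k`
by a rotation of the `k`-th plane through the principal angle `φ k`
(`IsPrincipalVectors.exists_isRotationFrame`). Where `φ k ≠ 0`, let `n k` be the unit normal to
`u k` in this plane; where `φ k = 0`, nothing is rotated.

Rotating all `u k` at once through `t φ k` moves `W` to `V`, and the reflections `I - 2 P` in the
rotated subspaces form a curve in `SO(p)` from `Φ(W)` to `Φ(V)` of constant speed
`2 (∑ φ k ^ 2)^(1/2)` (`curveLength_rotationCurve`). This bounds the distance from above.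

For the lower bound no theory of geodesics is needed. Let `γ` be any `C¹` curve in `SO(p)`, and let
`x` be an orthonormal family. Each `t ↦ γ t (x k)` is an arc on the unit sphere, so its length is at
least the angle `α k` between its endpoints (`arccos_inner_le_integral`). By Bessel's inequality the
speeds of these arcs satisfy `∑ ‖γ' (x k)‖ ^ 2 ≤ ‖γ'‖ ^ 2` in the Frobenius norm, which is twice the
squared Riemannian speed, as `γ' γᵀ` is antisymmetric. With the Cauchy-Schwarz inequality this gives
`(∑ α k ^ 2)^(1/2) ≤ √2 · length γ` (`IsC1Curve.sum_arccos_sq_le`). Applied to the vectors `u k` and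
`n k` with `φ k ≠ 0`, whose images under `Φ(W)` and `Φ(V)` enclose the angle `2 φ k`, it yields
`2 (∑ φ k ^ 2)^(1/2) ≤ length γ` (`two_mul_sqrt_le_curveLength`).

`Φ` is bijective because an orthogonal involution is symmetric, hence determined by its
`(-1)`-eigenspace.
-/

namespace GrassmannInvolution

open scoped Matrix

/-! ### Arcs on the unit sphere -/

/-- The spherical distance of the endpoints of a `C¹` arc on the unit sphere is at most the length
of the arc. -/
lemma arccos_inner_le_integral {F : Type*} [NormedAddCommGroup F] [InnerProductSpace ℝ F]
    {y y' : ℝ → F} (hy : ∀ t ∈ Icc (0 : ℝ) 1, HasDerivWithinAt y (y' t) (Icc 0 1) t)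
    (hc : ContinuousOn y' (Icc 0 1)) (hn : ∀ t ∈ Icc (0 : ℝ) 1, ‖y t‖ = 1) :
    Real.arccos (inner ℝ (y 0) (y 1)) ≤ ∫ t in (0 : ℝ)..1, ‖y' t‖ := by
  have h0 : (0 : ℝ) ∈ Icc (0 : ℝ) 1 := by simp
  have hyc : ContinuousOn y (Icc 0 1) := fun t ht => (hy t ht).continuousWithinAt
  -- `arccos` is not differentiable at `1`, so the inner product is first shrunk by a factor `r < 1`
  have key : ∀ r ∈ Ioo (0 : ℝ) 1,
      Real.arccos (r * inner ℝ (y 0) (y 1)) - Real.arccos r ≤ ∫ t in (0 : ℝ)..1, ‖y' t‖ := by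
    rintro r ⟨hr0, hr1⟩
    have hself : inner ℝ (y 0) (y 0) = (1 : ℝ) := by
      rw [real_inner_self_eq_norm_sq, hn 0 h0, one_pow]
    have habs : ∀ t ∈ Icc (0 : ℝ) 1, |inner ℝ (y 0) (y t)| ≤ 1 := fun t ht => by
      simpa [hn 0 h0, hn t ht] using abs_real_inner_le_norm (y 0) (y t)
    have h := intervalIntegral.sub_le_integral_of_hasDeriv_right_of_le (a := 0) (b := 1)
      (g := fun t => Real.arccos (r * inner ℝ (y 0) (y t)))
      (g' := fun t => -(1 / Real.sqrt (1 - (r * inner ℝ (y 0) (y t)) ^ 2)) *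
        (r * inner ℝ (y 0) (y' t)))
      (φ := fun t => ‖y' t‖) zero_le_one
      (Real.continuous_arccos.comp_continuousOn
        (continuousOn_const.mul (continuousOn_const.inner hyc)))
      ?_ (hc.norm.integrableOn_Icc) ?_
    · simpa only [hself, mul_one] using h
    · intro t ht
      have hd : HasDerivAt y (y' t) t :=
        (hy t (Ioo_subset_Icc_self ht)).hasDerivAt (Icc_mem_nhds ht.1 ht.2)
      have hg : HasDerivAt (fun t => r * inner ℝ (y 0) (y t)) (r * inner ℝ (y 0) (y' t)) t := by
        simpa using ((hasDerivAt_const t (y 0)).inner ℝ hd).const_mul r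
      have hlt : |r * inner ℝ (y 0) (y t)| < 1 := by
        rw [abs_mul, abs_of_pos hr0]
        have := habs t (Ioo_subset_Icc_self ht)
        nlinarith [abs_nonneg (inner ℝ (y 0) (y t))]
      obtain ⟨hl, hu⟩ := abs_lt.1 hlt
      exact ((Real.hasDerivAt_arccos hl.ne' hu.ne).comp t hg).hasDerivWithinAt
    · intro t ht
      have ht' := Ioo_subset_Icc_self ht
      have hd : HasDerivAt y (y' t) t := (hy t ht').hasDerivAt (Icc_mem_nhds ht.1 ht.2)
      have horth : inner ℝ (y t) (y' t) = (0 : ℝ) := by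
        have e : (fun s => inner ℝ (y s) (y s)) =ᶠ[nhds t] fun _ => (1 : ℝ) := by
          filter_upwards [Icc_mem_nhds ht.1 ht.2] with s hs
          rw [real_inner_self_eq_norm_sq, hn s hs, one_pow]
        have := (hd.inner ℝ hd).unique ((hasDerivAt_const t (1 : ℝ)).congr_of_eventuallyEq e)
        rw [real_inner_comm (y t) (y' t)] at this
        linarith
      set g : ℝ := inner ℝ (y 0) (y t) with hg
      have hgabs : g ^ 2 ≤ 1 := by
        have := habs t ht'
        rwa [← sq_le_one_iff_abs_le_one] at this
      have hproj : inner ℝ (y 0) (y' t) = inner ℝ (y 0 - g • y t) (y' t) := by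
        rw [inner_sub_left, real_inner_smul_left, horth, mul_zero, sub_zero]
      have hnorm : ‖y 0 - g • y t‖ ^ 2 = 1 - g ^ 2 := by
        rw [norm_sub_sq_real, hn 0 h0, inner_smul_right, norm_smul, hn t ht', ← hg,
          Real.norm_eq_abs, mul_one, sq_abs]
        ring
      have hcs : |inner ℝ (y 0) (y' t)| ≤ ‖y 0 - g • y t‖ * ‖y' t‖ := by
        rw [hproj]; exact abs_real_inner_le_norm _ _
      have hpos : 0 < 1 - (r * g) ^ 2 := by
        rw [mul_pow]
        nlinarith [sq_nonneg g, mul_self_nonneg r]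
      have hle : r * ‖y 0 - g • y t‖ ≤ Real.sqrt (1 - (r * g) ^ 2) := by
        apply Real.le_sqrt_of_sq_le
        rw [mul_pow, hnorm]
        nlinarith
      rw [neg_mul, one_div, inv_mul_eq_div, ← neg_div, div_le_iff₀ (Real.sqrt_pos.2 hpos)]
      calc -(r * inner ℝ (y 0) (y' t)) ≤ r * |inner ℝ (y 0) (y' t)| := by
            nlinarith [neg_abs_le (inner ℝ (y 0) (y' t))]
        _ ≤ r * (‖y 0 - g • y t‖ * ‖y' t‖) := by gcongr
        _ = r * ‖y 0 - g • y t‖ * ‖y' t‖ := by ring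
        _ ≤ Real.sqrt (1 - (r * g) ^ 2) * ‖y' t‖ := by gcongr
        _ = _ := mul_comm _ _
  have hlim : Filter.Tendsto
      (fun r : ℝ => Real.arccos (r * inner ℝ (y 0) (y 1)) - Real.arccos r) (nhdsWithin 1 (Iio 1))
      (nhds (Real.arccos (1 * inner ℝ (y 0) (y 1)) - Real.arccos 1)) := by
    refine Filter.Tendsto.mono_left (Continuous.tendsto ?_ 1) nhdsWithin_le_nhds
    exact (Real.continuous_arccos.comp (continuous_id.mul continuous_const)).sub
      Real.continuous_arccos
  rw [one_mul, Real.arccos_one, sub_zero] at hlim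
  refine le_of_tendsto hlim ?_
  filter_upwards [Ioo_mem_nhdsLT zero_lt_one] with r hr using key r hr

/-! ### Curves in the special orthogonal group -/

lemma coe_inv_SO {p : ℕ} (U : SO p) : ((U⁻¹ : SO p) : Mat p) = (U : Mat p)ᵀ := rfl

lemma SO_mul_transpose {p : ℕ} (U : SO p) : (U : Mat p) * (U : Mat p)ᵀ = 1 :=
  (Matrix.mem_orthogonalGroup_iff _ _).1 (Matrix.mem_specialOrthogonalGroup_iff.1 U.2).1

lemma SO_transpose_mul {p : ℕ} (U : SO p) : (U : Mat p)ᵀ * (U : Mat p) = 1 :=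
  (Matrix.mem_orthogonalGroup_iff' _ _).1 (Matrix.mem_specialOrthogonalGroup_iff.1 U.2).1

lemma inner_eq_dotProduct {p : ℕ} (x y : E p) : inner ℝ x y = x.ofLp ⬝ᵥ y.ofLp := by
  rw [EuclideanSpace.inner_eq_star_dotProduct, star_trivial, dotProduct_comm]

lemma toEuclideanLin_apply_eq_sum {p : ℕ} (A : Mat p) (x : E p) :
    Matrix.toEuclideanLin A x = WithLp.toLp 2 fun i => ∑ j, A i j * x j := rfl

lemma inner_SO_apply {p : ℕ} (U : SO p) (x y : E p) :
    inner ℝ (Matrix.toEuclideanLin (U : Mat p) x) (Matrix.toEuclideanLin (U : Mat p) y)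
      = inner ℝ x y := by
  rw [inner_eq_dotProduct, inner_eq_dotProduct, Matrix.ofLp_toLpLin,
    Matrix.ofLp_toLpLin, Matrix.toLin'_apply, Matrix.toLin'_apply,
    Matrix.dotProduct_mulVec, Matrix.vecMul_mulVec, ← Matrix.dotProduct_mulVec, SO_transpose_mul,
    Matrix.one_mulVec]

lemma norm_SO_apply {p : ℕ} (U : SO p) (x : E p) :
    ‖Matrix.toEuclideanLin (U : Mat p) x‖ = ‖x‖ := by
  rw [norm_eq_sqrt_real_inner, inner_SO_apply, ← norm_eq_sqrt_real_inner]

lemma IsC1Curve.hasDerivWithinAt {p : ℕ} {γ : ℝ → SO p} (hγ : IsC1Curve γ) {t : ℝ}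
    (ht : t ∈ Icc (0 : ℝ) 1) (i j : Fin p) :
    HasDerivWithinAt (fun s => (γ s : Mat p) i j) (velocity γ t i j) (Icc 0 1) t :=
  ((hγ i j).differentiableOn one_ne_zero t ht).hasDerivWithinAt

lemma IsC1Curve.continuousOn_velocity {p : ℕ} {γ : ℝ → SO p} (hγ : IsC1Curve γ) (i j : Fin p) :
    ContinuousOn (fun t => velocity γ t i j) (Icc 0 1) :=
  (hγ i j).continuousOn_derivWithin (uniqueDiffOn_Icc zero_lt_one) le_rfl

/-- Differentiating `γ γᵀ = 1` shows that `γ' γᵀ` is antisymmetric. -/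
lemma IsC1Curve.velocity_mul_transpose {p : ℕ} {γ : ℝ → SO p} (hγ : IsC1Curve γ) {t : ℝ}
    (ht : t ∈ Icc (0 : ℝ) 1) :
    velocity γ t * (γ t : Mat p)ᵀ = -((γ t : Mat p) * (velocity γ t)ᵀ) := by
  rw [eq_neg_iff_add_eq_zero]
  ext i j
  have h1 : HasDerivWithinAt (fun s => ((γ s : Mat p) * (γ s : Mat p)ᵀ) i j)
      ((velocity γ t * (γ t : Mat p)ᵀ + (γ t : Mat p) * (velocity γ t)ᵀ) i j) (Icc 0 1) t := by
    simp only [Matrix.mul_apply, Matrix.add_apply, Matrix.transpose_apply,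
      ← Finset.sum_add_distrib]
    exact HasDerivWithinAt.fun_sum fun k _ =>
      (hγ.hasDerivWithinAt ht i k).mul (hγ.hasDerivWithinAt ht j k)
  simp only [SO_mul_transpose] at h1
  exact ((uniqueDiffOn_Icc zero_lt_one) t ht).eq_deriv _ h1 (hasDerivWithinAt_const _ _ _)

/-- The speed of a curve in `SO(p)` is, up to the factor `1/√2`, the Frobenius norm of its
velocity. -/
lemma IsC1Curve.soMetric_velocity {p : ℕ} {γ : ℝ → SO p} (hγ : IsC1Curve γ) {t : ℝ}
    (ht : t ∈ Icc (0 : ℝ) 1) :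
    soMetric (γ t) (velocity γ t) (velocity γ t) = 1 / 2 * ∑ i, ∑ j, velocity γ t i j ^ 2 := by
  have h : velocity γ t * (γ t : Mat p)ᵀ * (velocity γ t * (γ t : Mat p)ᵀ)
      = -(velocity γ t * (velocity γ t)ᵀ) := by
    conv_lhs => enter [2]; rw [hγ.velocity_mul_transpose ht]
    rw [Matrix.mul_neg, Matrix.mul_assoc, ← Matrix.mul_assoc (γ t : Mat p)ᵀ, SO_transpose_mul,
      Matrix.one_mul]
  rw [soMetric, soInner, coe_inv_SO, h, Matrix.trace_neg, Matrix.trace]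
  simp [Matrix.mul_apply, sq]

/-- **Bessel's inequality** for the rows of a matrix. -/
lemma sum_norm_toEuclideanLin_sq_le {p : ℕ} {ι : Type*} [Fintype ι] {x : ι → E p}
    (hx : Orthonormal ℝ x) (A : Mat p) :
    ∑ k, ‖Matrix.toEuclideanLin A (x k)‖ ^ 2 ≤ ∑ i, ∑ j, A i j ^ 2 := by
  have h : ∀ k, ‖Matrix.toEuclideanLin A (x k)‖ ^ 2
      = ∑ i, ‖inner ℝ (x k) (WithLp.toLp 2 (A i) : E p)‖ ^ 2 := fun k => by
    rw [EuclideanSpace.norm_sq_eq]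
    refine Finset.sum_congr rfl fun i _ => ?_
    rw [real_inner_comm, inner_eq_dotProduct]
    rfl
  simp_rw [h]
  rw [Finset.sum_comm]
  refine Finset.sum_le_sum fun i _ => (hx.sum_inner_products_le _).trans_eq ?_
  rw [EuclideanSpace.norm_sq_eq]
  simp

/-- A curve in `SO(p)` moves the members of an orthonormal family along arcs of the unit sphere;
its length bounds the spherical distances of their endpoints in quadratic mean. -/
theorem IsC1Curve.sum_arccos_sq_le {p : ℕ} {γ : ℝ → SO p} (hγ : IsC1Curve γ) {ι : Type*}
    [Fintype ι] {x : ι → E p} (hx : Orthonormal ℝ x) :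
    Real.sqrt (∑ k, Real.arccos (inner ℝ (Matrix.toEuclideanLin (γ 0 : Mat p) (x k))
      (Matrix.toEuclideanLin (γ 1 : Mat p) (x k))) ^ 2) ≤ Real.sqrt 2 * curveLength γ := by
  set a : ι → ℝ := fun k => Real.arccos (inner ℝ (Matrix.toEuclideanLin (γ 0 : Mat p) (x k))
      (Matrix.toEuclideanLin (γ 1 : Mat p) (x k))) with ha
  set D := Real.sqrt (∑ k, a k ^ 2) with hD
  have hDD : D * D = ∑ k, a k ^ 2 :=
    Real.mul_self_sqrt (Finset.sum_nonneg fun _ _ => sq_nonneg _)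
  let w : ι → ℝ → E p := fun k t => Matrix.toEuclideanLin (velocity γ t) (x k)
  let S : ℝ → ℝ := fun t => Real.sqrt (soMetric (γ t) (velocity γ t) (velocity γ t))
  have hwc : ∀ k, ContinuousOn (w k) (Icc 0 1) := fun k => by
    simp only [w, toEuclideanLin_apply_eq_sum]
    refine (PiLp.continuous_toLp 2 _).comp_continuousOn (continuousOn_pi.2 fun i => ?_)
    exact continuousOn_finsetSum _ fun j _ =>
      (hγ.continuousOn_velocity i j).mul continuousOn_const
  have hSc : ContinuousOn S (Icc 0 1) := by
    refine Real.continuous_sqrt.comp_continuousOn (ContinuousOn.congr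
      (f := fun t => 1 / 2 * ∑ i, ∑ j, velocity γ t i j ^ 2) ?_ fun t ht => hγ.soMetric_velocity ht)
    exact continuousOn_const.mul (continuousOn_finsetSum _ fun i _ =>
      continuousOn_finsetSum _ fun j _ => (hγ.continuousOn_velocity i j).pow 2)
  have harc : ∀ k, a k ≤ ∫ t in (0 : ℝ)..1, ‖w k t‖ := fun k => by
    refine arccos_inner_le_integral
      (y := fun t => Matrix.toEuclideanLin (γ t : Mat p) (x k)) (fun t ht => ?_) (hwc k)
      (fun t _ => by rw [norm_SO_apply, hx.1 k])
    simp only [w, toEuclideanLin_apply_eq_sum]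
    have hpi : HasDerivWithinAt (fun s i => ∑ j, (γ s : Mat p) i j * x k j)
        (fun i => ∑ j, velocity γ t i j * x k j) (Icc 0 1) t :=
      hasDerivWithinAt_pi.2 fun i =>
        HasDerivWithinAt.fun_sum fun j _ => (hγ.hasDerivWithinAt ht i j).mul_const _
    exact (PiLp.hasFDerivAt_toLp (𝕜 := ℝ) 2 _).comp_hasDerivWithinAt t hpi
  have hint : ∀ k, IntervalIntegrable (fun t => a k * ‖w k t‖) MeasureTheory.volume 0 1 := fun k =>
    ContinuousOn.intervalIntegrable (by
      rw [uIcc_of_le zero_le_one]; exact continuousOn_const.mul (hwc k).norm)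
  have hpt : ∀ t ∈ Icc (0 : ℝ) 1, ∑ k, a k * ‖w k t‖ ≤ D * Real.sqrt 2 * S t := fun t ht => by
    have h2 : Real.sqrt (∑ k, ‖w k t‖ ^ 2) ≤ Real.sqrt 2 * S t := by
      rw [← Real.sqrt_mul zero_le_two, hγ.soMetric_velocity ht]
      refine Real.sqrt_le_sqrt ?_
      have := sum_norm_toEuclideanLin_sq_le hx (velocity γ t)
      linarith
    calc ∑ k, a k * ‖w k t‖ ≤ D * Real.sqrt (∑ k, ‖w k t‖ ^ 2) :=
          Real.sum_mul_le_sqrt_mul_sqrt _ _ _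
      _ ≤ D * (Real.sqrt 2 * S t) := by gcongr
      _ = _ := (mul_assoc _ _ _).symm
  have hfin : D * D ≤ D * (Real.sqrt 2 * curveLength γ) := by
    calc D * D = ∑ k, a k * a k := by rw [hDD]; simp [sq]
      _ ≤ ∑ k, a k * ∫ t in (0 : ℝ)..1, ‖w k t‖ :=
          Finset.sum_le_sum fun k _ => mul_le_mul_of_nonneg_left (harc k) (Real.arccos_nonneg _)
      _ = ∫ t in (0 : ℝ)..1, ∑ k, a k * ‖w k t‖ := by
          rw [intervalIntegral.integral_finsetSum fun k _ => hint k]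
          simp
      _ ≤ ∫ t in (0 : ℝ)..1, D * Real.sqrt 2 * S t := by
          refine intervalIntegral.integral_mono_on zero_le_one
            (by simpa only [Finset.sum_fn] using
              IntervalIntegrable.sum Finset.univ fun k _ => hint k) ?_ hpt
          refine ContinuousOn.intervalIntegrable ?_
          rw [uIcc_of_le zero_le_one]
          exact continuousOn_const.mul hSc
      _ = D * (Real.sqrt 2 * curveLength γ) := by
          rw [intervalIntegral.integral_const_mul, mul_assoc]
          rfl
  rcases (show 0 ≤ D from Real.sqrt_nonneg _).eq_or_lt with h0 | hpos
  · rw [← h0]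
    refine mul_nonneg (Real.sqrt_nonneg _) ?_
    exact intervalIntegral.integral_nonneg zero_le_one fun t _ => Real.sqrt_nonneg _
  · exact le_of_mul_le_mul_left hfin hpos

/-! ### Reflections in the span of an orthonormal family -/

/-- The `p × m` matrix whose columns are the vectors `q k`. -/
def colMatrix {m p : ℕ} (q : Fin m → E p) : Matrix (Fin p) (Fin m) ℝ :=
  Matrix.of fun i k => q k i

lemma colMatrix_transpose_mul_apply {m p : ℕ} (q r : Fin m → E p) (k l : Fin m) :
    ((colMatrix q)ᵀ * colMatrix r) k l = inner ℝ (q k) (r l) := by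
  rw [inner_eq_dotProduct]
  rfl

lemma colMatrix_transpose_mul_self {m p : ℕ} {q : Fin m → E p} (hq : Orthonormal ℝ q) :
    (colMatrix q)ᵀ * colMatrix q = 1 := by
  ext k l
  rw [colMatrix_transpose_mul_apply, orthonormal_iff_ite.1 hq, Matrix.one_apply]

lemma reflection_mem_SO {m p : ℕ} (hm : Even m) {q : Fin m → E p} (hq : Orthonormal ℝ q) :
    1 - 2 • (colMatrix q * (colMatrix q)ᵀ) ∈ Matrix.specialOrthogonalGroup (Fin p) ℝ := by
  have h := colMatrix_transpose_mul_self hq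
  rw [Matrix.mem_specialOrthogonalGroup_iff, Matrix.mem_orthogonalGroup_iff]
  constructor
  · have h2 : colMatrix q * (colMatrix q)ᵀ * (colMatrix q * (colMatrix q)ᵀ)
        = colMatrix q * (colMatrix q)ᵀ := by
      rw [Matrix.mul_assoc, ← Matrix.mul_assoc (colMatrix q)ᵀ, h, Matrix.one_mul]
    rw [Matrix.transpose_sub, Matrix.transpose_one, Matrix.transpose_smul, Matrix.transpose_mul,
      Matrix.transpose_transpose, sub_mul, mul_sub, mul_sub, smul_mul_smul_comm, h2]
    simp only [mul_one, one_mul]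
    module
  · rw [← Matrix.mul_smul, Matrix.det_one_sub_mul_comm, Matrix.smul_mul, h,
      show (1 - 2 • 1 : Matrix (Fin m) (Fin m) ℝ) = -1 by module, Matrix.det_neg, Matrix.det_one,
      Fintype.card_fin, hm.neg_one_pow, mul_one]

lemma starProjection_eq_sum {m p : ℕ} {W : Submodule ℝ (E p)} (hW : finrank ℝ W = m)
    {q : Fin m → E p} (hq : Orthonormal ℝ q) (hqW : ∀ k, q k ∈ W) (x : E p) :
    W.starProjection x = ∑ k, inner ℝ (q k) x • q k := by
  have hspan : Submodule.span ℝ (range q) = W := by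
    refine Submodule.eq_of_le_of_finrank_eq (Submodule.span_le.2 ?_) ?_
    · rintro _ ⟨k, rfl⟩
      exact hqW k
    · rw [finrank_span_eq_card hq.linearIndependent, hW, Fintype.card_fin]
  refine Submodule.eq_starProjection_of_mem_of_inner_eq_zero
    (W.sum_mem fun k _ => W.smul_mem _ (hqW k)) fun w hw => ?_
  have hle : Submodule.span ℝ (range q) ≤ (ℝ ∙ (x - ∑ k, inner ℝ (q k) x • q k))ᗮ := by
    rw [Submodule.span_le]
    rintro _ ⟨l, rfl⟩
    rw [SetLike.mem_coe, Submodule.mem_orthogonal_singleton_iff_inner_left, inner_sub_right,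
      hq.inner_right_fintype, sub_self]
  exact Submodule.mem_orthogonal_singleton_iff_inner_right.1 (hle (hspan ▸ hw))

lemma projMatrix_eq_colMatrix_mul {m p : ℕ} {W : Submodule ℝ (E p)} (hW : finrank ℝ W = m)
    {q : Fin m → E p} (hq : Orthonormal ℝ q) (hqW : ∀ k, q k ∈ W) :
    projMatrix W = colMatrix q * (colMatrix q)ᵀ := by
  ext i j
  rw [projMatrix, LinearMap.toMatrix_apply]
  simp only [OrthonormalBasis.coe_toBasis, OrthonormalBasis.coe_toBasis_repr_apply,
    ContinuousLinearMap.coe_coe, starProjection_eq_sum hW hq hqW, EuclideanSpace.basisFun_repr,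
    EuclideanSpace.basisFun_apply]
  simp [Matrix.mul_apply, colMatrix, EuclideanSpace.inner_single_right, mul_comm]

/-! ### Rotating one plane into another -/

/-- Vectors `u k`, `n k` spanning mutually orthogonal planes in which to rotate through the angles
`φ k`. Where `φ k = 0` there is nothing to rotate, and `n k` need not be a unit vector. -/
structure IsRotationFrame {m p : ℕ} (φ : Fin m → ℝ) (u n : Fin m → E p) : Prop where
  orthonormal : Orthonormal ℝ u
  inner_cross : ∀ i j, inner ℝ (u i) (n j) = 0
  orthogonal : ∀ i j, i ≠ j → inner ℝ (n i) (n j) = 0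
  norm_eq_one : ∀ i, φ i ≠ 0 → ‖n i‖ = 1

/-- The vector `u k` turned towards `n k` through the angle `θ k`. -/
noncomputable def rotate {m p : ℕ} (u n : Fin m → E p) (θ : Fin m → ℝ) (k : Fin m) : E p :=
  Real.cos (θ k) • u k + Real.sin (θ k) • n k

/-- The velocity of `t ↦ rotate u n (t • φ)`. -/
noncomputable def rotateDeriv {m p : ℕ} (u n : Fin m → E p) (φ : Fin m → ℝ) (t : ℝ)
    (k : Fin m) : E p :=
  φ k • (-Real.sin (t * φ k) • u k + Real.cos (t * φ k) • n k)

section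

variable {m p : ℕ} {φ : Fin m → ℝ} {u n : Fin m → E p}

lemma IsRotationFrame.inner_self (h : IsRotationFrame φ u n) (i : Fin m) :
    inner ℝ (u i) (u i) = (1 : ℝ) := by
  rw [real_inner_self_eq_norm_sq, h.orthonormal.1 i, one_pow]

lemma IsRotationFrame.inner_cross' (h : IsRotationFrame φ u n) (i j : Fin m) :
    inner ℝ (n i) (u j) = (0 : ℝ) := by
  rw [real_inner_comm, h.inner_cross]

lemma IsRotationFrame.inner_self' (h : IsRotationFrame φ u n) {i : Fin m} (hi : φ i ≠ 0) :
    inner ℝ (n i) (n i) = (1 : ℝ) := by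
  rw [real_inner_self_eq_norm_sq, h.norm_eq_one i hi, one_pow]

lemma IsRotationFrame.orthonormal_rotate (h : IsRotationFrame φ u n) (t : ℝ) :
    Orthonormal ℝ (rotate u n fun k => t * φ k) := by
  rw [orthonormal_iff_ite]
  intro i j
  simp only [rotate, inner_add_left, inner_add_right, real_inner_smul_left, real_inner_smul_right,
    h.inner_cross, h.inner_cross', mul_zero, add_zero, zero_add]
  split_ifs with hij
  · subst hij
    rw [h.inner_self]
    by_cases hi : φ i = 0
    · simp [hi]
    · rw [h.inner_self' hi]
      linear_combination Real.sin_sq_add_cos_sq (t * φ i)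
  · rw [h.orthogonal i j hij, h.orthonormal.2 hij]
    simp

lemma IsRotationFrame.inner_rotate_rotateDeriv (h : IsRotationFrame φ u n) (t : ℝ) (i j : Fin m) :
    inner ℝ (rotate u n (fun k => t * φ k) i) (rotateDeriv u n φ t j) = 0 := by
  simp only [rotate, rotateDeriv, inner_add_left, inner_add_right, real_inner_smul_left,
    real_inner_smul_right, h.inner_cross, h.inner_cross', mul_zero, add_zero, zero_add]
  by_cases hij : i = j
  · subst hij
    rw [h.inner_self]
    by_cases hi : φ i = 0
    · simp [hi]
    · rw [h.inner_self' hi]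
      ring
  · rw [h.orthogonal i j hij, h.orthonormal.2 hij]
    simp

lemma IsRotationFrame.inner_rotateDeriv (h : IsRotationFrame φ u n) (t : ℝ) (i : Fin m) :
    inner ℝ (rotateDeriv u n φ t i) (rotateDeriv u n φ t i) = φ i ^ 2 := by
  simp only [rotateDeriv, inner_add_left, inner_add_right, real_inner_smul_left,
    real_inner_smul_right, h.inner_cross, h.inner_cross', mul_zero, add_zero, zero_add]
  rw [h.inner_self]
  by_cases hi : φ i = 0
  · simp [hi]
  · rw [h.inner_self' hi]
    linear_combination φ i ^ 2 * Real.sin_sq_add_cos_sq (t * φ i)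

/-- The curve of the reflections in the planes spanned by the rotated vectors. -/
noncomputable def rotationCurve (hm : Even m) (h : IsRotationFrame φ u n) (t : ℝ) : SO p :=
  ⟨_, reflection_mem_SO hm (h.orthonormal_rotate t)⟩

lemma rotationCurve_apply (hm : Even m) (h : IsRotationFrame φ u n) (t : ℝ) (i j : Fin p) :
    (rotationCurve hm h t : Mat p) i j = (1 : Mat p) i j - 2 * ∑ k,
      rotate u n (fun k => t * φ k) k i * rotate u n (fun k => t * φ k) k j := by
  change (1 - 2 • (colMatrix _ * (colMatrix _)ᵀ) : Mat p) i j = _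
  rw [Matrix.sub_apply, Matrix.smul_apply, nsmul_eq_mul, Nat.cast_ofNat]
  rfl

lemma hasDerivAt_rotate_apply (t : ℝ) (k : Fin m) (i : Fin p) :
    HasDerivAt (fun s => rotate u n (fun k => s * φ k) k i) (rotateDeriv u n φ t k i) t := by
  have h0 : HasDerivAt (fun s => s * φ k) (φ k) t := hasDerivAt_mul_const _
  have h1 := (h0.cos.mul_const (u k i)).add (h0.sin.mul_const (n k i))
  refine h1.congr_deriv ?_
  simp only [rotateDeriv, PiLp.smul_apply, PiLp.add_apply, smul_eq_mul]
  ring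

lemma isC1Curve_rotationCurve (hm : Even m) (h : IsRotationFrame φ u n) :
    IsC1Curve (rotationCurve hm h) := by
  intro i j
  simp only [rotationCurve_apply, rotate, PiLp.smul_apply, PiLp.add_apply, smul_eq_mul]
  fun_prop

lemma velocity_rotationCurve (hm : Even m) (h : IsRotationFrame φ u n) {t : ℝ}
    (ht : t ∈ Icc (0 : ℝ) 1) : velocity (rotationCurve hm h) t = -(2 : ℝ) •
      (colMatrix (rotateDeriv u n φ t) * (colMatrix (rotate u n fun k => t * φ k))ᵀ
        + colMatrix (rotate u n fun k => t * φ k) * (colMatrix (rotateDeriv u n φ t))ᵀ) := by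
  ext i j
  have hd : HasDerivAt (fun s => (rotationCurve hm h s : Mat p) i j)
      (-(2 * ∑ k, (rotateDeriv u n φ t k i * rotate u n (fun k => t * φ k) k j
        + rotate u n (fun k => t * φ k) k i * rotateDeriv u n φ t k j))) t := by
    simp only [rotationCurve_apply]
    exact ((HasDerivAt.fun_sum fun k _ =>
      (hasDerivAt_rotate_apply t k i).mul (hasDerivAt_rotate_apply t k j)).const_mul 2).const_sub _
  rw [velocity, Matrix.of_apply,
    hd.hasDerivWithinAt.derivWithin (uniqueDiffOn_Icc zero_lt_one t ht)]
  simp [Matrix.mul_apply, colMatrix, Finset.sum_add_distrib]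

/-- The curve of rotating reflections has constant speed `2 (∑ φ k ^ 2)^(1/2)`. -/
lemma curveLength_rotationCurve (hm : Even m) (h : IsRotationFrame φ u n) :
    curveLength (rotationCurve hm h) = 2 * Real.sqrt (∑ k, φ k ^ 2) := by
  have key : ∀ t ∈ Icc (0 : ℝ) 1, Real.sqrt (soMetric (rotationCurve hm h t)
      (velocity (rotationCurve hm h) t) (velocity (rotationCurve hm h) t))
      = 2 * Real.sqrt (∑ k, φ k ^ 2) := fun t ht => by
    have hfrob : ∀ A : Mat p, ∑ i, ∑ j, A i j ^ 2 = (A * Aᵀ).trace := fun A => by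
      simp [Matrix.trace, Matrix.mul_apply, sq]
    rw [(isC1Curve_rotationCurve hm h).soMetric_velocity ht, hfrob, velocity_rotationCurve hm h ht]
    set Q := colMatrix (rotate u n fun k => t * φ k) with hQ
    set Q' := colMatrix (rotateDeriv u n φ t) with hQ'
    have h1 : Qᵀ * Q = 1 := colMatrix_transpose_mul_self (h.orthonormal_rotate t)
    have h2 : Qᵀ * Q' = 0 := by
      ext i j
      rw [colMatrix_transpose_mul_apply, h.inner_rotate_rotateDeriv]
      rfl
    have h3 : (Q'ᵀ * Q').trace = ∑ k, φ k ^ 2 := by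
      refine Finset.sum_congr rfl fun k _ => ?_
      rw [Matrix.diag_apply, colMatrix_transpose_mul_apply, h.inner_rotateDeriv]
    have h4 : Q'ᵀ * Q = 0 := by
      rw [← Matrix.transpose_transpose (Q'ᵀ * Q), Matrix.transpose_mul,
        Matrix.transpose_transpose, h2, Matrix.transpose_zero]
    have h5 : (Q' * Qᵀ + Q * Q'ᵀ) * (Q' * Qᵀ + Q * Q'ᵀ)ᵀ
        = Q' * Q'ᵀ + Q * (Q'ᵀ * Q' * Qᵀ) := by
      simp only [Matrix.transpose_add, Matrix.transpose_mul, Matrix.transpose_transpose,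
        Matrix.add_mul, Matrix.mul_add, Matrix.mul_assoc]
      simp only [← Matrix.mul_assoc Qᵀ, ← Matrix.mul_assoc Q'ᵀ Q, h1, h2, h4, Matrix.one_mul,
        Matrix.zero_mul, Matrix.mul_zero, add_zero, zero_add]
    rw [Matrix.transpose_smul, Matrix.smul_mul, Matrix.mul_smul, h5, Matrix.trace_smul,
      Matrix.trace_smul, Matrix.trace_add, Matrix.trace_mul_comm Q', Matrix.trace_mul_comm Q,
      Matrix.mul_assoc, h1, Matrix.mul_one, h3, smul_eq_mul, smul_eq_mul,
      show 1 / 2 * (-2 * (-2 * (∑ k, φ k ^ 2 + ∑ k, φ k ^ 2))) = 2 ^ 2 * ∑ k, φ k ^ 2 by ring,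
      Real.sqrt_mul (by norm_num), Real.sqrt_sq zero_le_two]
  rw [curveLength, intervalIntegral.integral_congr (g := fun _ => 2 * Real.sqrt (∑ k, φ k ^ 2))
    fun t ht => key t (by rwa [uIcc_of_le zero_le_one] at ht)]
  simp

end

/-! ### Principal vectors -/

lemma IsPrincipalVectors.orthonormal {m p : ℕ} {W Z : Submodule ℝ (E p)} {u v : Fin m → E p}
    (h : IsPrincipalVectors W Z u v) : Orthonormal ℝ u := by
  refine ⟨h.norm_left, fun i j hij => ?_⟩
  rcases lt_or_gt_of_ne hij with hlt | hgt
  · exact h.orth_left j i hlt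
  · rw [real_inner_comm]
    exact h.orth_left i j hgt

/-- Principal vectors `u k`, `v k` span mutually orthogonal planes, in which `v k` arises from `u k`
by a rotation through the principal angle. -/
lemma IsPrincipalVectors.exists_isRotationFrame {m p : ℕ} {W Z : Submodule ℝ (E p)}
    {u v : Fin m → E p} (h : IsPrincipalVectors W Z u v) {φ : Fin m → ℝ}
    (hφ : ∀ k, φ k ∈ Icc 0 (Real.pi / 2) ∧ Real.cos (φ k) = inner ℝ (u k) (v k)) :
    ∃ n : Fin m → E p, IsRotationFrame φ u n ∧ v = rotate u n φ := by
  have huu : ∀ i, inner ℝ (u i) (u i) = (1 : ℝ) := fun i => by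
    rw [real_inner_self_eq_norm_sq, h.norm_left, one_pow]
  have hvv : ∀ i, inner ℝ (v i) (v i) = (1 : ℝ) := fun i => by
    rw [real_inner_self_eq_norm_sq, h.norm_right, one_pow]
  have hvu : ∀ i j, i ≠ j → inner ℝ (v i) (u j) = (0 : ℝ) := fun i j hij => by
    rw [real_inner_comm, h.inner_cross hij.symm]
  have hsin : ∀ k, φ k ≠ 0 → Real.sin (φ k) ≠ 0 := fun k hk =>
    (Real.sin_pos_of_pos_of_lt_pi ((hφ k).1.1.lt_of_ne hk.symm)
      ((hφ k).1.2.trans_lt (by linarith [Real.pi_pos]))).ne'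
  -- where `φ k = 0`, the inverse `0⁻¹ = 0` makes `n k` the zero vector
  refine ⟨fun k => (Real.sin (φ k))⁻¹ • (v k - Real.cos (φ k) • u k),
    ⟨h.orthonormal, fun i j => ?_, fun i j hij => ?_, fun i hi => ?_⟩, funext fun k => ?_⟩
  · rw [real_inner_smul_right, inner_sub_right, real_inner_smul_right]
    by_cases hij : i = j
    · rw [hij, huu, (hφ j).2]
      ring
    · rw [h.inner_cross hij, h.orthonormal.2 hij]
      simp
  · simp [real_inner_smul_left, real_inner_smul_right, inner_sub_left, inner_sub_right,
      h.inner_cross hij, hvu i j hij, h.orthonormal.2 hij, h.symm.orthonormal.2 hij]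
  · have hs := hsin i hi
    rw [← sq_eq_sq₀ (norm_nonneg _) zero_le_one, ← real_inner_self_eq_norm_sq,
      real_inner_smul_left, real_inner_smul_right, inner_sub_left, inner_sub_right,
      inner_sub_right, real_inner_smul_left, real_inner_smul_left, real_inner_smul_right,
      real_inner_smul_right, huu, hvv, real_inner_comm (u i) (v i), ← (hφ i).2]
    field_simp
    linear_combination -Real.sin_sq_add_cos_sq (φ i)
  · rw [rotate]
    by_cases hk : φ k = 0
    · have h1 : inner ℝ (u k) (v k) = (1 : ℝ) := by rw [← (hφ k).2, hk, Real.cos_zero]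
      rw [(inner_eq_one_iff_of_norm_eq_one (h.norm_left k) (h.norm_right k)).1 h1, hk]
      simp
    · rw [smul_inv_smul₀ (hsin k hk), add_sub_cancel]

/-! ### The distance between two reflections -/

section

variable {m p : ℕ} {W V : Gr m p} {u v : Fin m → E p}

lemma Phi_coe_eq (hm : Even m) (hm0 : 0 < m) (h : Orthonormal ℝ u) (hu : ∀ k, u k ∈ W.1) :
    ((Phi hm hm0 W).1 : Mat p) = 1 - 2 • (colMatrix u * (colMatrix u)ᵀ) := by
  rw [← projMatrix_eq_colMatrix_mul W.2 h hu]
  rfl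

lemma Phi_apply (hm : Even m) (hm0 : 0 < m) (h : Orthonormal ℝ u) (hu : ∀ k, u k ∈ W.1) (x : E p) :
    Matrix.toEuclideanLin ((Phi hm hm0 W).1 : Mat p) x
      = x - (2 : ℝ) • ∑ k, inner ℝ (u k) x • u k := by
  rw [← starProjection_eq_sum W.2 h hu]
  exact toEuclideanLin_one_sub W.1 x

/-- Both vectors of each plane of the frame are moved by `Φ(V) Φ(W)⁻¹` through twice the rotation
angle; the factor `√2` of `IsC1Curve.sum_arccos_sq_le` accounts for the two vectors. -/
lemma two_mul_sqrt_le_curveLength (hm : Even m) (hm0 : 0 < m) {n : Fin m → E p} {φ : Fin m → ℝ}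
    (h : IsRotationFrame φ u n) (hφ : ∀ k, φ k ∈ Icc 0 (Real.pi / 2)) (hu : ∀ k, u k ∈ W.1)
    (hv : ∀ k, rotate u n φ k ∈ V.1) {γ : ℝ → SO p} (hγ : IsC1Curve γ)
    (h0 : γ 0 = (Phi hm hm0 W).1) (h1 : γ 1 = (Phi hm hm0 V).1) :
    2 * Real.sqrt (∑ k, φ k ^ 2) ≤ curveLength γ := by
  have hvo : Orthonormal ℝ (rotate u n φ) := by simpa using h.orthonormal_rotate 1
  -- planes without rotation are left out, as `n k` is not a unit vector there
  let x : {k // φ k ≠ 0} ⊕ {k // φ k ≠ 0} → E p := Sum.elim (fun k => u k) fun k => n k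
  have hx : Orthonormal ℝ x := by
    constructor
    · rintro (k | k)
      · exact h.orthonormal.1 k
      · exact h.norm_eq_one k k.2
    · rintro (k | k) (l | l) hkl
      · exact h.orthonormal.2 fun e => hkl (congrArg Sum.inl (Subtype.ext e))
      · exact h.inner_cross k l
      · exact h.inner_cross' k l
      · exact h.orthogonal k l fun e => hkl (congrArg Sum.inr (Subtype.ext e))
  have hru : ∀ j k, inner ℝ (rotate u n φ j) (u k) = if j = k then Real.cos (φ k) else 0 := by
    intro j k
    rw [rotate, inner_add_left, real_inner_smul_left, real_inner_smul_left, h.inner_cross',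
      orthonormal_iff_ite.1 h.orthonormal]
    split_ifs with hjk <;> simp [hjk]
  have hrn : ∀ j k, φ k ≠ 0 →
      inner ℝ (rotate u n φ j) (n k) = if j = k then Real.sin (φ k) else 0 := by
    intro j k hk
    rw [rotate, inner_add_left, real_inner_smul_left, real_inner_smul_left, h.inner_cross]
    split_ifs with hjk
    · rw [hjk, h.inner_self' hk]
      simp
    · rw [h.orthogonal j k hjk]
      simp
  have harc : ∀ k, Real.arccos (Real.cos (2 * φ k)) = 2 * φ k := fun k =>
    Real.arccos_cos (by linarith [(hφ k).1]) (by linarith [(hφ k).2])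
  have hangle : ∀ k, Real.arccos (inner ℝ (Matrix.toEuclideanLin (γ 0 : Mat p) (x k))
      (Matrix.toEuclideanLin (γ 1 : Mat p) (x k)))
        = 2 * φ (Sum.elim (fun k => k.1) (fun k => k.1) k) := by
    rw [h0, h1]
    rintro (k | k)
    -- `Φ(W)` negates `u k`, and `Φ(V)` subtracts `2 cos (φ k)` times the rotated vector
    · simp only [x, Sum.elim_inl, Phi_apply hm hm0 h.orthonormal hu, Phi_apply hm hm0 hvo hv, hru,
        orthonormal_iff_ite.1 h.orthonormal, ite_smul, zero_smul, one_smul, Finset.sum_ite_eq',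
        Finset.mem_univ, if_true]
      rw [← harc k, Real.cos_two_mul]
      congr 1
      have := hru k k
      rw [if_pos rfl] at this
      rw [inner_sub_right, real_inner_smul_right, real_inner_smul_right, inner_sub_left,
        inner_sub_left, real_inner_smul_left, real_inner_smul_left, h.inner_self,
        real_inner_comm (rotate u n φ k) (u k), this]
      ring
    -- `Φ(W)` fixes `n k`, and `Φ(V)` subtracts `2 sin (φ k)` times the rotated vector
    · simp only [x, Sum.elim_inr, Phi_apply hm hm0 h.orthonormal hu, Phi_apply hm hm0 hvo hv,
        hrn _ _ k.2, h.inner_cross, ite_smul, zero_smul, Finset.sum_const_zero, smul_zero, sub_zero,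
        Finset.sum_ite_eq', Finset.mem_univ, if_true]
      rw [← harc k, Real.cos_two_mul]
      congr 1
      have := hrn k k k.2
      rw [if_pos rfl] at this
      rw [inner_sub_right, real_inner_smul_right, real_inner_smul_right, h.inner_self' k.2,
        real_inner_comm (rotate u n φ k) (n k), this]
      linear_combination -2 * Real.sin_sq_add_cos_sq (φ k)
  have hmain := hγ.sum_arccos_sq_le hx
  simp only [hangle, Fintype.sum_sum_type, Sum.elim_inl, Sum.elim_inr] at hmain
  have hsum : ∑ k : {k // φ k ≠ 0}, (2 * φ k) ^ 2 = 2 ^ 2 * ∑ k, φ k ^ 2 := by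
    rw [Finset.mul_sum, ← Finset.sum_subtype (Finset.univ.filter fun k => φ k ≠ 0) (by simp)
      fun k => (2 * φ k) ^ 2, Finset.sum_filter_of_ne]
    · simp_rw [mul_pow]
    · intro k _ hk e
      simp [e] at hk
  rw [hsum, ← two_mul, Real.sqrt_mul zero_le_two, Real.sqrt_mul (by norm_num),
    Real.sqrt_sq zero_le_two] at hmain
  exact le_of_mul_le_mul_left hmain (by positivity)

theorem dSO_Phi (hm : Even m) (hm0 : 0 < m) (W V : Gr m p) :
    dSO (Phi hm hm0 W).1 (Phi hm hm0 V).1 = 2 * dGr W V := by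
  obtain ⟨u, v, h, hφ⟩ := principalAngle_spec W V
  obtain ⟨n, hf, rfl⟩ := h.exists_isRotationFrame hφ
  have hlow : ∀ L ∈ {L : ℝ | ∃ γ : ℝ → SO p, IsC1Curve γ ∧ γ 0 = (Phi hm hm0 W).1 ∧
      γ 1 = (Phi hm hm0 V).1 ∧ L = curveLength γ}, 2 * dGr W V ≤ L := by
    rintro _ ⟨γ, hγ, h0, h1, rfl⟩
    exact two_mul_sqrt_le_curveLength hm hm0 hf (fun k => (hφ k).1) h.mem_left h.mem_right hγ h0 h1
  have hmem : 2 * dGr W V ∈ {L : ℝ | ∃ γ : ℝ → SO p, IsC1Curve γ ∧ γ 0 = (Phi hm hm0 W).1 ∧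
      γ 1 = (Phi hm hm0 V).1 ∧ L = curveLength γ} := by
    refine ⟨rotationCurve hm hf, isC1Curve_rotationCurve hm hf, Subtype.ext ?_, Subtype.ext ?_,
      (curveLength_rotationCurve hm hf).symm⟩
    · rw [Phi_coe_eq hm hm0 hf.orthonormal h.mem_left]
      have : rotate u n (fun k => 0 * principalAngle W V k) = u := by
        funext k
        simp [rotate]
      simp only [rotationCurve, this]
    · rw [Phi_coe_eq hm hm0 h.symm.orthonormal h.mem_right]
      simp only [rotationCurve, one_mul]
  exact le_antisymm (csInf_le ⟨_, hlow⟩ hmem) (le_csInf ⟨_, hmem⟩ hlow)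

end

/-! ### Bijectivity -/

theorem Phi_injective {m p : ℕ} (hm : Even m) (hm0 : 0 < m) :
    Function.Injective (Phi hm hm0 : Gr m p → Inv m p) := by
  intro W V h
  have h1 : (1 - 2 • projMatrix W.1 : Mat p) = 1 - 2 • projMatrix V.1 :=
    congrArg (fun R : Inv m p => (R.1 : Mat p)) h
  refine Subtype.ext ?_
  rw [← negEigenspace_one_sub W.1, h1, negEigenspace_one_sub]

/-- An orthogonal involution `R` is symmetric, so `(1 - R) / 2` is the orthogonal projection onto
its `(-1)`-eigenspace. -/
theorem Phi_surjective {m p : ℕ} (hm : Even m) (hm0 : 0 < m) :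
    Function.Surjective (Phi hm hm0 : Gr m p → Inv m p) := by
  rintro ⟨R, hR, hR1, hRm⟩
  have hRR : ∀ x : E p, Matrix.toEuclideanLin (R : Mat p) (Matrix.toEuclideanLin (R : Mat p) x) = x
      := fun x => by
    have h2 : (R : Mat p) * (R : Mat p) = 1 := congrArg Subtype.val hR
    rw [Matrix.toLpLin_apply, Matrix.toLpLin_apply, Matrix.mulVec_mulVec, h2,
      Matrix.one_mulVec]
  refine ⟨⟨negEigenspace (R : Mat p), hRm⟩, Subtype.ext (Subtype.ext ?_)⟩
  change 1 - 2 • projMatrix (negEigenspace (R : Mat p)) = (R : Mat p)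
  apply (Matrix.toEuclideanLin (𝕜 := ℝ) (m := Fin p) (n := Fin p)).injective
  ext1 x
  have hproj : (negEigenspace (R : Mat p)).starProjection x
      = (2⁻¹ : ℝ) • (x - Matrix.toEuclideanLin (R : Mat p) x) := by
    refine Submodule.eq_starProjection_of_mem_of_inner_eq_zero ?_ fun w hw => ?_
    · rw [negEigenspace, Module.End.mem_eigenspace_iff, map_smul, map_sub, hRR]
      module
    · rw [negEigenspace, Module.End.mem_eigenspace_iff, neg_one_smul] at hw
      have h3 : inner ℝ (Matrix.toEuclideanLin (R : Mat p) x) w = -inner ℝ x w := by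
        rw [← inner_SO_apply R, hRR, hw, inner_neg_right]
      rw [inner_sub_left, real_inner_smul_left, inner_sub_left, h3]
      ring
  rw [toEuclideanLin_one_sub, hproj, smul_inv_smul₀ two_ne_zero, sub_sub_cancel]

end GrassmannInvolution

open GrassmannInvolution
theorem mainTheorem6 (m p : ℕ) (hm : Even m) (hm0 : 0 < m) (hmp : m ≤ p) :
    Function.Bijective (Phi hm hm0 : Gr m p → Inv m p) ∧
      ∀ W V : Gr m p, dSO (Phi hm hm0 W).1 (Phi hm hm0 V).1 = 2 * dGr W V :=
  ⟨⟨Phi_injective hm hm0, Phi_surjective hm hm0⟩, dSO_Phi hm hm0⟩
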